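/- For integers $p > d \ge 0$ let $\mathcal G_{p,d}$ be the set of simple graphs on the vertex set $V=\{1,\dots,p\}$ in which every vertex has degree at most $d$. For $\lambda,\omega>0$ and $G=(V,E)$, let $\Theta_{\lambda,\omega}(G)$ be the set of edge-weight vectors $\theta\in\mathbb R^{\binom p2}$ such that $\theta_{st}=0$ for $(s,t)\notin E$, $|\theta_{st}|\ge\lambda$ for $(s,t)\in E$, and $\sum_{t:(s,t)\in E}|\theta_{st}|\le\omega$ for every $s\in V$. Let $\mathbb P_\theta(x)\propto\exp\big(\sum_{s<t}\theta_{st}x_sx_t\big)$, $x\in\{-1,+1\}^p$, be the Ising model with edge weights $\theta$; the family $\mathcal G_{p,d}(\lambda,\omega)$ consists of all $\mathbb P_\theta$ with $\theta\in\Theta_{\lambda,\omega}(G)$, $G\in\mathcal G_{p,d}$. In the known-edge-weight problem, a weight vector $\theta(G)$ is specified for each candidate graph $G$ and is known to the decoder; a graph decoder is a map $\phi$ from $n$ samples in $\{-1,+1\}^p$ to $\mathcal G_{p,d}$, which may depend on the assignment $G\mapsto\theta(G)$. Corollary 3. For every $W>0$ there is a constant $c_1>0$, depending only on $W$, such that the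 following holds. Let $(n_k,p_k,d_k,\lambda_k,\omega_k)_{k}$ be any sequence of problems with increasing maximum degree, $d_k\to\infty$ and $d_k<p_k$, with $\lambda_k>0$ and bounded neighborhood weight $0<\omega_k\le W$, and with sample sizes $$n_k > c_1\,\max\{d_k^2,\lambda_k^{-2}\}\,d_k\log p_k .$$ Then, for known edge weights, some graph decoder succeeds with high probability: there is a sequence $\delta_k\to0$ such that for every $k$ and every assignment $G\mapsto\theta(G)$ there is a graph decoder $\phi_k$ (using $n_k$ samples) with $$\mathbb P_{\theta(G)}\big[\phi_k(X_1,\dots,X_{n_k})\neq G\big]\le\delta_k$$ for every $G\in\mathcal G_{p_k,d_k}$ with $\theta(G)\in\Theta_{\lambda_k,\omega_k}(G)$, where $X_1,\dots,X_{n_k}$ are i.i.d. from $\mathbb P_{\theta(G)}$. -/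

import Mathlib

open Filter Topology

namespace IsingSelection

/-- Spin configurations `x ∈ {-1, +1}^p` (`ℤˣ = {1, -1}`). -/
abbrev Config (p : ℕ) : Type := Fin p → ℤˣ

/-- Edge weights `θ`, one real number `θ s(s, t)` for every unordered pair of vertices; values on
the diagonal are never used. -/
abbrev EdgeWeights (p : ℕ) : Type := Sym2 (Fin p) → ℝ

/-- The exponent `∑_{s < t} θ_{st} x_s x_t` of the Ising model. When `θ` vanishes off the edge set
of a graph, this is the sum over the edges of that graph. -/
noncomputable def energy {p : ℕ} (θ : EdgeWeights p) (x : Config p) : ℝ :=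
  ∑ s : Fin p, ∑ t ∈ Finset.Ioi s, θ s(s, t) * ((x s : ℤ) : ℝ) * ((x t : ℤ) : ℝ)

/-- The normalization constant of the Ising model. -/
noncomputable def partitionFunction {p : ℕ} (θ : EdgeWeights p) : ℝ :=
  ∑ x : Config p, Real.exp (energy θ x)

/-- The probability mass function of the Ising model with edge weights `θ`. -/
noncomputable def isingProb {p : ℕ} (θ : EdgeWeights p) (x : Config p) : ℝ :=
  Real.exp (energy θ x) / partitionFunction θ

/-- The graphs on `p` vertices all of whose vertices have degree at most `d`. -/
def boundedDegreeGraphs (p d : ℕ) : Set (SimpleGraph (Fin p)) :=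
  {G | ∀ s : Fin p, (G.neighborSet s).ncard ≤ d}

open Classical in
/-- The edge weights `θ` that respect the graph `G` and have minimum absolute edge weight at least
`lam` and maximum neighborhood weight at most `om`. -/
structure IsAdmissible {p : ℕ} (G : SimpleGraph (Fin p)) (lam om : ℝ) (θ : EdgeWeights p) :
    Prop where
  /-- `θ_{st}` is nonzero only on edges. -/
  support : ∀ s t : Fin p, ¬ G.Adj s t → θ s(s, t) = 0
  /-- Every edge has weight at least `lam` in absolute value. -/
  minWeight : ∀ s t : Fin p, G.Adj s t → lam ≤ |θ s(s, t)|
  /-- Every neighborhood has total absolute weight at most `om`. -/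
  neighborhoodWeight : ∀ s : Fin p, ∑ t : Fin p with G.Adj s t, |θ s(s, t)| ≤ om

/-- Graph decoders: maps from `n` samples to graphs of maximum degree at most `d`. -/
abbrev Decoder (n p d : ℕ) : Type := (Fin n → Config p) → boundedDegreeGraphs p d

open Classical in
/-- The probability that the decoder `φ`, applied to `n` i.i.d. samples from the Ising model with
edge weights `θ`, does not output the graph `G`. -/
noncomputable def errorProb {n p d : ℕ} (φ : Decoder n p d) (θ : EdgeWeights p)
    (G : SimpleGraph (Fin p)) : ℝ :=
  ∑ X : Fin n → Config p with (φ X : SimpleGraph (Fin p)) ≠ G, ∏ i : Fin n, isingProb θ (X i)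

end IsingSelection

/-! The decoder is maximum likelihood among the graphs whose assigned weights are admissible. Its
error is at most the sum, over wrong candidates, of the `n`-th power of the Bhattacharyya
coefficient (`exists_maximumLikelihood`).

For weights `θ`, `θ'` with midpoint `μ` this coefficient is `Z(μ) / √(Z(θ) Z(θ'))`, so its decay
measures the strong convexity of `log Z` on the segment from `θ'` to `θ`. The second derivative
there is the variance of the energy of `δ = (θ - θ') / 2`. The heart of the proof is the
dimension-free bound `RowBounded.sum_sq_le_variance`: this variance is at least a constant depending
on `W` times `∑ δ_st ^ 2`. It is proved by Cauchy–Schwarz against a test function built from the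
residuals `x_s - E[x_s | rest]`. Integration by parts in one spin (`expect_mul_residual`) computes
the moments; conditional variances are bounded below because local fields are at most `W`, and
correlations between residuals are controlled by the row sums of `|θ|`.

Two graphs differing on the set `D` of ordered pairs have weights at squared distance at least `lam
^ 2 * |D|`, so a wrong candidate contributes at most `q ^ |D|` with `q` exponentially small in `n *
lam ^ 2`. Summing over all nonempty `D` gives `(1 + q) ^ (p ^ 2) - 1`, which tends to zero. -/

namespace IsingSelection

/-! ### Estimates for the hyperbolic tangent. -/

section HyperbolicTangent

theorem lipschitzWith_tanh : LipschitzWith 1 Real.tanh := by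
  have hderiv : ∀ x, HasDerivAt Real.tanh (1 - Real.tanh x ^ 2) x := fun x => by
    have h := (Real.hasDerivAt_sinh x).div (Real.hasDerivAt_cosh x) (Real.cosh_pos x).ne'
    have e : Real.tanh = fun y => Real.sinh y / Real.cosh y :=
      funext Real.tanh_eq_sinh_div_cosh
    rw [e]
    refine h.congr_deriv ?_
    have := (Real.cosh_pos x).ne'
    field_simp
  refine lipschitzWith_of_nnnorm_deriv_le (fun x => (hderiv x).differentiableAt) fun x => ?_
  rw [(hderiv x).deriv, ← NNReal.coe_le_coe, coe_nnnorm, Real.norm_eq_abs, NNReal.coe_one, abs_le]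
  constructor <;> nlinarith [Real.tanh_sq_lt_one x, sq_nonneg (Real.tanh x)]

theorem abs_tanh_sub_tanh_le (a b : ℝ) : |Real.tanh a - Real.tanh b| ≤ |a - b| := by
  simpa [Real.dist_eq] using lipschitzWith_tanh.dist_le_mul a b

theorem one_sub_tanh_sq (a : ℝ) : 1 - Real.tanh a ^ 2 = (Real.cosh a ^ 2)⁻¹ := by
  have := (Real.cosh_pos a).ne'
  rw [Real.tanh_eq_sinh_div_cosh, div_pow, Real.sinh_sq]
  field_simp
  ring

/-- Bounded local fields keep every conditional variance away from zero; this is where `W` enters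
the constants exponentially. -/
theorem inv_cosh_sq_le_one_sub_tanh_sq {a W : ℝ} (h : |a| ≤ W) :
    (Real.cosh W ^ 2)⁻¹ ≤ 1 - Real.tanh a ^ 2 := by
  rw [one_sub_tanh_sq]
  have h1 : Real.cosh a ≤ Real.cosh W := Real.cosh_le_cosh.2 (h.trans (le_abs_self W))
  have h2 := Real.cosh_pos a
  gcongr

end HyperbolicTangent

/-! ### Spin reversal and integration by parts. -/

variable {p : ℕ}

/-- The spin at `s` as a real number. -/
def spin (x : Config p) (s : Fin p) : ℝ := ((x s : ℤ) : ℝ)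

/-- Reverse the spin at `s`. -/
def flip (s : Fin p) (x : Config p) : Config p := Function.update x s (-x s)

/-- The local field `∑ t, θ_{st} x_t` at `s`. -/
noncomputable def field (θ : EdgeWeights p) (s : Fin p) (x : Config p) : ℝ :=
  ∑ t, θ s(s, t) * spin x t

/-- The coefficient of `x_s` in `F`. -/
noncomputable def spinDeriv (s : Fin p) (F : Config p → ℝ) (x : Config p) : ℝ :=
  spin x s * (F x - F (flip s x)) / 2

/-- The deviation of the spin at `s` from its conditional mean given the other spins. -/
noncomputable def residual (θ : EdgeWeights p) (s : Fin p) (x : Config p) : ℝ :=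
  spin x s - Real.tanh (field θ s x)

/-- The conditional variance of the spin at `s` given the other spins. -/
noncomputable def condVar (θ : EdgeWeights p) (s : Fin p) (x : Config p) : ℝ :=
  1 - Real.tanh (field θ s x) ^ 2

/-- Expectation in the Ising model. -/
noncomputable def expect (θ : EdgeWeights p) (F : Config p → ℝ) : ℝ :=
  ∑ x, isingProb θ x * F x

theorem spin_mul_self (x : Config p) (s : Fin p) : spin x s * spin x s = 1 := by
  rcases Int.units_eq_one_or (x s) with h | h <;> simp [spin, h]

theorem abs_spin (x : Config p) (s : Fin p) : |spin x s| = 1 := by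
  rcases Int.units_eq_one_or (x s) with h | h <;> simp [spin, h]

@[simp] theorem spin_flip_self (x : Config p) (s : Fin p) : spin (flip s x) s = -spin x s := by
  simp [spin, flip]

theorem spin_flip_of_ne (x : Config p) {s t : Fin p} (h : t ≠ s) :
    spin (flip s x) t = spin x t := by
  simp [spin, flip, Function.update_of_ne h]

theorem spin_flip (x : Config p) (s t : Fin p) :
    spin (flip s x) t = spin x t - 2 * (if t = s then spin x s else 0) := by
  by_cases h : t = s
  · subst h; simp; ring
  · simp [spin_flip_of_ne x h, h]

@[simp] theorem flip_flip (s : Fin p) (x : Config p) : flip s (flip s x) = x := by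
  simp [flip]

/-- Spin reversal as a permutation of the configurations. -/
def flipEquiv (s : Fin p) : Config p ≃ Config p where
  toFun := flip s
  invFun := flip s
  left_inv := flip_flip s
  right_inv := flip_flip s

theorem sum_flip (s : Fin p) (F : Config p → ℝ) : ∑ x, F (flip s x) = ∑ x, F x :=
  (flipEquiv s).sum_comp F

theorem partitionFunction_pos (θ : EdgeWeights p) : 0 < partitionFunction θ :=
  Finset.sum_pos (fun _ _ => Real.exp_pos _) Finset.univ_nonempty

theorem isingProb_pos (θ : EdgeWeights p) (x : Config p) : 0 < isingProb θ x :=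
  div_pos (Real.exp_pos _) (partitionFunction_pos θ)

theorem sum_isingProb (θ : EdgeWeights p) : ∑ x, isingProb θ x = 1 := by
  simp only [isingProb, ← Finset.sum_div]
  exact div_self (partitionFunction_pos θ).ne'

theorem field_flip (θ : EdgeWeights p) (s t : Fin p) (x : Config p) :
    field θ s (flip t x) = field θ s x - 2 * θ s(s, t) * spin x t := by
  simp only [field, spin_flip, mul_sub, Finset.sum_sub_distrib]
  congr 1
  rw [Finset.sum_eq_single t] <;> simp +contextual
  ring

/-- The factor 1/2 appears because each unordered pair is counted from both of its endpoints. -/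
theorem energy_eq_sum_field {θ : EdgeWeights p} (hdiag : ∀ s, θ s(s, s) = 0) (x : Config p) :
    energy θ x = (∑ s, spin x s * field θ s x) / 2 := by
  have hlt : energy θ x = ∑ s, ∑ t, if s < t then θ s(s, t) * spin x s * spin x t else 0 := by
    refine Finset.sum_congr rfl fun s _ => ?_
    rw [← Finset.sum_filter]
    refine Finset.sum_congr ?_ fun t _ => rfl
    ext t; simp
  have hgt : energy θ x = ∑ s, ∑ t, if t < s then θ s(s, t) * spin x s * spin x t else 0 := by
    rw [hlt, Finset.sum_comm]
    refine Finset.sum_congr rfl fun s _ => Finset.sum_congr rfl fun t _ => ?_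
    rw [Sym2.eq_swap]
    congr 1
    ring
  have hall : energy θ x + energy θ x = ∑ s, spin x s * field θ s x := by
    nth_rewrite 1 [hlt]
    rw [hgt]
    simp only [field, Finset.mul_sum, ← Finset.sum_add_distrib]
    refine Finset.sum_congr rfl fun s _ => Finset.sum_congr rfl fun t _ => ?_
    rcases lt_trichotomy s t with h | h | h
    · simp [h, h.not_gt]; ring
    · subst h; simp [hdiag]
    · simp [h, h.not_gt]; ring
  linarith

theorem energy_flip {θ : EdgeWeights p} (hdiag : ∀ s, θ s(s, s) = 0) (s : Fin p) (x : Config p) :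
    energy θ (flip s x) = energy θ x - 2 * spin x s * field θ s x := by
  rw [energy_eq_sum_field hdiag, energy_eq_sum_field hdiag]
  have h1 : ∀ a, spin (flip s x) a * field θ a (flip s x) = spin x a * field θ a x
      - 2 * spin x s * (θ s(s, a) * spin x a)
      - (if a = s then 2 * spin x s * field θ a x - 4 * θ s(a, s) else 0) := fun a => by
    rw [field_flip, spin_flip, Sym2.eq_swap (a := s)]
    split_ifs with h
    · subst h
      linear_combination 4 * θ s(a, a) * spin_mul_self x a
    · ring
  simp only [h1, Finset.sum_sub_distrib, ← Finset.mul_sum, Finset.sum_ite_eq', Finset.mem_univ,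
    if_true, hdiag]
  rw [← field]
  ring

/-- Integration by parts with respect to the spin at `s`. -/
theorem expect_mul_residual {θ : EdgeWeights p} (hdiag : ∀ s, θ s(s, s) = 0) (s : Fin p)
    (F : Config p → ℝ) :
    expect θ (fun x => F x * residual θ s x) =
      expect θ (fun x => spinDeriv s F x * condVar θ s x) := by
  have key : ∀ A B : Config p → ℝ, (∀ x, A x + A (flip s x) = B x + B (flip s x)) →
      ∑ x, A x = ∑ x, B x := fun A B h => by
    have h2 := Finset.sum_congr rfl fun x (_ : x ∈ Finset.univ) => h x
    rw [Finset.sum_add_distrib, Finset.sum_add_distrib, sum_flip, sum_flip] at h2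
    linarith
  -- It suffices to compare the two sides on each pair `{x, flip s x}`, where the local field at `s`
  -- is constant.
  refine key _ _ fun x => ?_
  have hf : field θ s (flip s x) = field θ s x := by simp [field_flip, hdiag]
  simp only [residual, condVar, spinDeriv, flip_flip, hf, spin_flip_self, isingProb,
    energy_flip hdiag, one_sub_tanh_sq]
  have hZ := (partitionFunction_pos θ).ne'
  have hc := (Real.cosh_pos (field θ s x)).ne'
  rw [Real.tanh_eq_sinh_div_cosh]
  set η := field θ s x
  have hE : Real.exp (energy θ x - 2 * spin x s * η) =
      Real.exp (energy θ x) * Real.exp (-(spin x s * η)) * Real.exp (-(spin x s * η)) := by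
    rw [← Real.exp_add, ← Real.exp_add]; congr 1; ring
  have hE2 : Real.exp (energy θ x) = Real.exp (energy θ x) * Real.exp (-(spin x s * η)) *
      Real.exp (spin x s * η) := by
    rw [← Real.exp_add, ← Real.exp_add]; congr 1; ring
  rw [hE]
  -- `K` is the part of the Gibbs weight common to the pair; the two weights are `K` times `exp (±
  -- spin x s * η)`.
  generalize Real.exp (energy θ x) * Real.exp (-(spin x s * η)) = K at *
  rw [hE2]
  have h1 := Real.cosh_sq η
  rcases (abs_eq zero_le_one).1 (abs_spin x s) with h | h <;> rw [h] <;>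
    simp only [one_mul, neg_mul, neg_neg] <;>
    rw [← Real.cosh_add_sinh η, ← Real.cosh_sub_sinh η] <;> field_simp
  · linear_combination K * Real.cosh η * (2 * F x - 2 * F (flip s x)) * h1
  · linear_combination -K * Real.cosh η * (2 * F x - 2 * F (flip s x)) * h1

/-! ### Expectations and discrete derivatives. -/

section Expectation

variable (θ : EdgeWeights p)

theorem expect_add (F G : Config p → ℝ) :
    expect θ (fun x => F x + G x) = expect θ F + expect θ G := by
  simp only [expect, mul_add, Finset.sum_add_distrib]

theorem expect_const_mul (c : ℝ) (F : Config p → ℝ) :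
    expect θ (fun x => c * F x) = c * expect θ F := by
  simp only [expect, Finset.mul_sum]
  exact Finset.sum_congr rfl fun x _ => by ring

theorem expect_const (c : ℝ) : expect θ (fun _ => c) = c := by
  simp only [expect, ← Finset.sum_mul, sum_isingProb, one_mul]

theorem expect_sum {ι : Type*} (I : Finset ι) (F : ι → Config p → ℝ) :
    expect θ (fun x => ∑ i ∈ I, F i x) = ∑ i ∈ I, expect θ (F i) := by
  simp only [expect, Finset.mul_sum]
  exact Finset.sum_comm

theorem expect_mono {F G : Config p → ℝ} (h : ∀ x, F x ≤ G x) : expect θ F ≤ expect θ G :=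
  Finset.sum_le_sum fun x _ => mul_le_mul_of_nonneg_left (h x) (isingProb_pos θ x).le

theorem expect_nonneg {F : Config p → ℝ} (h : ∀ x, 0 ≤ F x) : 0 ≤ expect θ F :=
  Finset.sum_nonneg fun x _ => mul_nonneg (isingProb_pos θ x).le (h x)

/-- The Cauchy–Schwarz inequality. -/
theorem expect_mul_sq_le (F G : Config p → ℝ) :
    expect θ (fun x => F x * G x) ^ 2 ≤
      expect θ (fun x => F x ^ 2) * expect θ (fun x => G x ^ 2) := by
  refine Finset.sum_sq_le_sum_mul_sum_of_sq_le_mul _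
    (fun x _ => mul_nonneg (isingProb_pos θ x).le (sq_nonneg _))
    (fun x _ => mul_nonneg (isingProb_pos θ x).le (sq_nonneg _)) fun x _ => le_of_eq (by ring)

end Expectation

/-- Discrete Leibniz rule. The flip on `F` disappears whenever `F` does not depend on the spin at
`s`. -/
theorem spinDeriv_mul (s : Fin p) (F G : Config p → ℝ) (x : Config p) :
    spinDeriv s (fun y => F y * G y) x =
      spinDeriv s F x * G x + F (flip s x) * spinDeriv s G x := by
  simp only [spinDeriv]; ring

theorem condVar_le_one (θ : EdgeWeights p) (s : Fin p) (x : Config p) : condVar θ s x ≤ 1 := by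
  simp only [condVar]; nlinarith [sq_nonneg (Real.tanh (field θ s x))]

theorem condVar_nonneg (θ : EdgeWeights p) (s : Fin p) (x : Config p) : 0 ≤ condVar θ s x := by
  simp only [condVar]; nlinarith [Real.tanh_sq_lt_one (field θ s x)]

theorem spinDeriv_field {θ : EdgeWeights p} (s t : Fin p) (x : Config p) :
    spinDeriv t (field θ s) x = θ s(s, t) := by
  simp only [spinDeriv, field_flip]
  linear_combination θ s(s, t) * spin_mul_self x t

theorem spinDeriv_energy {δ : EdgeWeights p} (hδ : ∀ s, δ s(s, s) = 0) (s : Fin p)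
    (x : Config p) : spinDeriv s (energy δ) x = field δ s x := by
  simp only [spinDeriv, energy_flip hδ]
  linear_combination field δ s x * spin_mul_self x s

theorem spinDeriv_residual_self {θ : EdgeWeights p} (hdiag : ∀ s, θ s(s, s) = 0) (s : Fin p)
    (x : Config p) : spinDeriv s (residual θ s) x = 1 := by
  simp only [spinDeriv, residual, field_flip, hdiag, spin_flip_self]
  simp only [mul_zero, zero_mul, sub_zero]
  linear_combination spin_mul_self x s

theorem abs_spinDeriv (s : Fin p) (F : Config p → ℝ) (x : Config p) :
    |spinDeriv s F x| = |F x - F (flip s x)| / 2 := by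
  rw [spinDeriv, abs_div, abs_mul, abs_spin, one_mul, abs_two]

theorem abs_tanh_field_sub_flip_le (θ : EdgeWeights p) (s t : Fin p) (x : Config p) :
    |Real.tanh (field θ s x) - Real.tanh (field θ s (flip t x))| ≤ 2 * |θ s(s, t)| := by
  refine (abs_tanh_sub_tanh_le _ _).trans_eq ?_
  rw [field_flip, sub_sub_cancel, abs_mul, abs_mul, abs_spin, mul_one, abs_two]

theorem abs_spinDeriv_residual_le (θ : EdgeWeights p) {s t : Fin p} (h : s ≠ t) (x : Config p) :
    |spinDeriv t (residual θ s) x| ≤ |θ s(s, t)| := by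
  rw [abs_spinDeriv]
  have := abs_tanh_field_sub_flip_le θ s t x
  simp only [residual, spin_flip_of_ne x h]
  rw [show spin x s - Real.tanh (field θ s x) - (spin x s - Real.tanh (field θ s (flip t x))) =
    -(Real.tanh (field θ s x) - Real.tanh (field θ s (flip t x))) by ring, abs_neg]
  linarith

theorem abs_spinDeriv_condVar_le (θ : EdgeWeights p) (s t : Fin p) (x : Config p) :
    |spinDeriv t (condVar θ s) x| ≤ 2 * |θ s(s, t)| := by
  rw [abs_spinDeriv]
  have h1 := abs_tanh_field_sub_flip_le θ s t x
  simp only [condVar]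
  set a := Real.tanh (field θ s x)
  set b := Real.tanh (field θ s (flip t x))
  have ha : |a| ≤ 1 := (Real.abs_tanh_lt_one _).le
  have hb : |b| ≤ 1 := (Real.abs_tanh_lt_one _).le
  rw [show 1 - a ^ 2 - (1 - b ^ 2) = -((a - b) * (a + b)) by ring, abs_neg, abs_mul]
  have h2 : |a + b| ≤ 2 := (abs_add_le a b).trans (by linarith)
  have h3 := mul_le_mul h1 h2 (abs_nonneg _) (by positivity)
  linarith

theorem abs_field_flip_le (δ : EdgeWeights p) (s t : Fin p) (x : Config p) :
    |field δ s (flip t x)| ≤ |field δ s x| + 2 * |δ s(s, t)| := by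
  rw [field_flip]
  refine (abs_sub _ _).trans ?_
  rw [abs_mul, abs_mul, abs_spin, abs_two, mul_one]

/-! ### Variance lower bounds under bounded neighborhood weight. -/

/-- Every neighborhood has total absolute weight at most `W`, and the diagonal vanishes. -/
structure RowBounded (θ : EdgeWeights p) (W : ℝ) : Prop where
  diag : ∀ s, θ s(s, s) = 0
  row : ∀ s, ∑ t, |θ s(s, t)| ≤ W

namespace RowBounded

variable {θ : EdgeWeights p} {W : ℝ}

theorem abs_le (hθ : RowBounded θ W) (s t : Fin p) : |θ s(s, t)| ≤ W :=
  (Finset.single_le_sum (f := fun t => |θ s(s, t)|) (fun _ _ => abs_nonneg _)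
    (Finset.mem_univ t)).trans (hθ.row s)

theorem abs_field_le (hθ : RowBounded θ W) (s : Fin p) (x : Config p) : |field θ s x| ≤ W := by
  refine (Finset.abs_sum_le_sum_abs _ _).trans (le_trans (le_of_eq ?_) (hθ.row s))
  exact Finset.sum_congr rfl fun t _ => by rw [abs_mul, abs_spin, mul_one]

theorem le_condVar (hθ : RowBounded θ W) (s : Fin p) (x : Config p) :
    (Real.cosh W ^ 2)⁻¹ ≤ condVar θ s x :=
  inv_cosh_sq_le_one_sub_tanh_sq (hθ.abs_field_le s x)

theorem sum_abs_mul_left_le (hθ : RowBounded θ W) {a : Fin p → ℝ} (ha : ∀ s, 0 ≤ a s) :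
    ∑ s, ∑ t, |θ s(s, t)| * a s ≤ W * ∑ s, a s := by
  rw [Finset.mul_sum]
  refine Finset.sum_le_sum fun s _ => ?_
  rw [← Finset.sum_mul]
  exact mul_le_mul_of_nonneg_right (hθ.row s) (ha s)

theorem sum_abs_mul_right_le (hθ : RowBounded θ W) {a : Fin p → ℝ} (ha : ∀ s, 0 ≤ a s) :
    ∑ s, ∑ t, |θ s(s, t)| * a t ≤ W * ∑ s, a s := by
  rw [Finset.sum_comm]
  refine le_of_eq_of_le ?_ (hθ.sum_abs_mul_left_le ha)
  exact Finset.sum_congr rfl fun s _ => Finset.sum_congr rfl fun t _ => by rw [Sym2.eq_swap]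

/-- After integration by parts at `t`, only the dependence of `residual θ s` on `x_t` remains; for
`s ≠ t` it passes through `θ_st` alone. Residuals are thus nearly orthogonal. -/
theorem expect_residual_mul_residual_le (hθ : RowBounded θ W) (s t : Fin p) :
    |expect θ (fun x => residual θ s x * residual θ t x)| ≤
      (if s = t then 1 else 0) + |θ s(s, t)| := by
  have hbound : ∀ x, |spinDeriv t (residual θ s) x * condVar θ t x| ≤
      (if s = t then 1 else 0) + |θ s(s, t)| := fun x => by
    rw [abs_mul, abs_of_nonneg (condVar_nonneg θ t x)]
    refine (mul_le_of_le_one_right (abs_nonneg _) (condVar_le_one θ t x)).trans ?_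
    by_cases h : s = t
    · subst h; simp [spinDeriv_residual_self hθ.diag]
    · simpa [h] using abs_spinDeriv_residual_le θ h x
  rw [expect_mul_residual hθ.diag, _root_.abs_le]
  constructor
  · rw [← expect_const θ (-_)]
    exact expect_mono θ fun x => (_root_.abs_le.1 (hbound x)).1
  · rw [← expect_const θ ((if s = t then 1 else 0) + _)]
    exact expect_mono θ fun x => (_root_.abs_le.1 (hbound x)).2

/-- A linear form in the spins has second moment at least a multiple of the squared norm of its
coefficients. -/
theorem sum_sq_le_expect_sq (hθ : RowBounded θ W) (hW : 0 ≤ W) (b : Fin p → ℝ) :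
    (Real.cosh W ^ 2)⁻¹ ^ 2 / (1 + W) * ∑ t, b t ^ 2 ≤
      expect θ (fun x => (∑ t, b t * spin x t) ^ 2) := by
  set c := (Real.cosh W ^ 2)⁻¹ with hc
  have hcpos : 0 < c := by have := Real.cosh_pos W; positivity
  set B := ∑ t, b t ^ 2 with hB
  have hB0 : 0 ≤ B := Finset.sum_nonneg fun _ _ => sq_nonneg _
  set h : Config p → ℝ := fun x => ∑ t, b t * spin x t with hh
  -- Test function for Cauchy–Schwarz: its correlation with `h` is at least `c * B`, while its
  -- second moment is at most `(1 + W) * B`.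
  set g : Config p → ℝ := fun x => ∑ t, b t * residual θ t x with hg
  have hD : ∀ t x, spinDeriv t h x = b t := fun t x => by
    simp only [spinDeriv, hh, spin_flip, ← Finset.sum_sub_distrib]
    rw [Finset.sum_eq_single t] <;> simp +contextual
    linear_combination b t * spin_mul_self x t
  have hcov : c * B ≤ expect θ (fun x => h x * g x) := by
    have e : (fun x => h x * g x) = fun x => ∑ t, b t * (h x * residual θ t x) := by
      funext x; simp only [hg, Finset.mul_sum]
      exact Finset.sum_congr rfl fun t _ => by ring
    rw [e, expect_sum, hB, Finset.mul_sum]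
    refine Finset.sum_le_sum fun t _ => ?_
    rw [expect_const_mul, expect_mul_residual hθ.diag]
    simp only [hD, expect_const_mul]
    have : c ≤ expect θ (condVar θ t) := by
      rw [← expect_const θ c]; exact expect_mono θ (hθ.le_condVar t)
    nlinarith [mul_le_mul_of_nonneg_left this (sq_nonneg (b t))]
  have hvar : expect θ (fun x => g x ^ 2) ≤ (1 + W) * B := by
    have e : (fun x => g x ^ 2) = fun x => ∑ s, ∑ t, (b s * b t) *
        (residual θ s x * residual θ t x) := by
      funext x; simp only [hg, sq, Finset.sum_mul_sum]
      exact Finset.sum_congr rfl fun s _ => Finset.sum_congr rfl fun t _ => by ring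
    rw [e]
    simp only [expect_sum, expect_const_mul]
    calc ∑ s, ∑ t, (b s * b t) * expect θ (fun x => residual θ s x * residual θ t x)
        ≤ ∑ s, ∑ t, ((if s = t then b s ^ 2 else 0) + (|θ s(s, t)| * (b s ^ 2 / 2) +
            |θ s(s, t)| * (b t ^ 2 / 2))) := by
          refine Finset.sum_le_sum fun s _ => Finset.sum_le_sum fun t _ => ?_
          refine (le_abs_self _).trans ?_
          rw [abs_mul]
          refine (mul_le_mul_of_nonneg_left (hθ.expect_residual_mul_residual_le s t)
            (abs_nonneg _)).trans ?_
          -- A Schur test: AM–GM reduces the quadratic form to row sums of `|θ|`, each at most `W`.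
          have h2 : |b s * b t| ≤ b s ^ 2 / 2 + b t ^ 2 / 2 := by
            rw [abs_mul]
            nlinarith [sq_nonneg (|b s| - |b t|), sq_abs (b s), sq_abs (b t)]
          have h3 := mul_le_mul_of_nonneg_right h2 (abs_nonneg (θ s(s, t)))
          by_cases hst : s = t
          · subst hst
            simp only [if_true, hθ.diag, abs_zero, add_zero, zero_mul, mul_one]
            rw [abs_mul_self]; nlinarith
          · simp only [hst, if_false, zero_add]
            linarith
      _ ≤ B + (W * ∑ s, b s ^ 2 / 2 + W * ∑ s, b s ^ 2 / 2) := by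
          simp only [Finset.sum_add_distrib]
          refine add_le_add (by simp [hB]) (add_le_add ?_ ?_)
          · exact hθ.sum_abs_mul_left_le fun s => by positivity
          · exact hθ.sum_abs_mul_right_le fun s => by positivity
      _ = (1 + W) * B := by rw [← Finset.sum_div]; ring
  have hcs := expect_mul_sq_le θ h g
  have h1 : (c * B) ^ 2 ≤ expect θ (fun x => h x ^ 2) * ((1 + W) * B) :=
    (pow_le_pow_left₀ (by positivity) hcov 2).trans (hcs.trans
      (mul_le_mul_of_nonneg_left hvar (expect_nonneg θ fun x => sq_nonneg _)))
  rcases hB0.eq_or_lt with h0 | h0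
  · rw [← h0, mul_zero]
    exact expect_nonneg θ fun x => sq_nonneg _
  · rw [div_mul_eq_mul_div, div_le_iff₀ (by positivity)]
    refine le_of_mul_le_mul_right ?_ h0
    calc c ^ 2 * B * B = (c * B) ^ 2 := by ring
      _ ≤ _ := h1
      _ = _ := by ring

/-- Integrating by parts at `t` leaves a term with the factor `δ_st` alone, which could not be
summed over pairs. That term still contains `residual θ s`, so a second integration, at `s`, yields
either another `δ_st` or a factor bounded by `|θ_st|`. Both kinds are summable after AM–GM. -/
theorem expect_field_residual_mul_le (hθ : RowBounded θ W) {δ : EdgeWeights p}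
    (hδ : ∀ s, δ s(s, s) = 0) {s t : Fin p} (hst : s ≠ t) :
    expect θ (fun x => (field δ s x * residual θ s x) * (field δ t x * residual θ t x)) ≤
      (1 + 6 * W) * δ s(s, t) ^ 2 + (3 * |θ s(s, t)| * expect θ (fun x => field δ t x ^ 2) +
        |θ s(s, t)| * expect θ (fun x => field δ s x ^ 2)) := by
  have hts : δ s(t, s) = δ s(s, t) := by rw [Sym2.eq_swap]
  have hts' : θ s(t, s) = θ s(s, t) := by rw [Sym2.eq_swap]
  set d := δ s(s, t) with hd
  set e := |θ s(s, t)| with he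
  have he0 : 0 ≤ e := abs_nonneg _
  have heW : e ≤ W := hθ.abs_le s t
  have e1 : (fun x => (field δ s x * residual θ s x) * (field δ t x * residual θ t x)) =
      fun x => (field δ t x * (field δ s x * residual θ s x)) * residual θ t x := by
    funext x; ring
  have e2 : (fun x => spinDeriv t (fun x => field δ t x * (field δ s x * residual θ s x)) x *
      condVar θ t x) = fun x => d * ((field δ t x * condVar θ t x) * residual θ s x) +
        field δ t x * field δ s (flip t x) * spinDeriv t (residual θ s) x * condVar θ t x := by
    funext x
    rw [spinDeriv_mul, spinDeriv_mul, spinDeriv_field, spinDeriv_field, hδ, field_flip δ t t, hδ]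
    ring
  have e3 : (fun x => spinDeriv s (fun x => field δ t x * condVar θ t x) x * condVar θ s x) =
      fun x => (d * condVar θ t x + field δ t (flip s x) * spinDeriv s (condVar θ t) x) *
        condVar θ s x := by
    funext x
    rw [spinDeriv_mul, spinDeriv_field, hts]
  rw [e1, expect_mul_residual hθ.diag, e2, expect_add, expect_const_mul,
    expect_mul_residual hθ.diag, e3, ← expect_const_mul, ← expect_add,
    ← expect_const_mul, ← expect_const_mul, ← expect_const θ ((1 + 6 * W) * d ^ 2),
    ← expect_add, ← expect_add]
  refine expect_mono θ fun x => ?_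
  have hA : |d| * |field δ t (flip s x)| * |spinDeriv s (condVar θ t) x| ≤
      |d| * (|field δ t x| + 2 * |d|) * (2 * e) := by
    have h1 := abs_field_flip_le δ t s x
    have h2 := abs_spinDeriv_condVar_le θ t s x
    rw [hts] at h1; rw [hts'] at h2
    gcongr
  have hB : |field δ t x| * |field δ s (flip t x)| * |spinDeriv t (residual θ s) x| ≤
      |field δ t x| * (|field δ s x| + 2 * |d|) * e := by
    have h1 := abs_field_flip_le δ s t x
    have h2 := abs_spinDeriv_residual_le θ hst x
    gcongr
  have hvt := condVar_le_one θ t x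
  have hvs := condVar_le_one θ s x
  have hvt0 := condVar_nonneg θ t x
  have hvs0 := condVar_nonneg θ s x
  have hmul : ∀ {a v : ℝ}, 0 ≤ v → v ≤ 1 → a * v ≤ |a| := fun {a v} h0 h1 =>
    (mul_le_mul_of_nonneg_right (le_abs_self a) h0).trans
      (mul_le_of_le_one_right (abs_nonneg a) h1)
  have t1 : d * ((d * condVar θ t x + field δ t (flip s x) * spinDeriv s (condVar θ t) x) *
      condVar θ s x) ≤ d ^ 2 + |d| * (|field δ t x| + 2 * |d|) * (2 * e) := by
    have h1 : d ^ 2 * (condVar θ t x * condVar θ s x) ≤ d ^ 2 :=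
      mul_le_of_le_one_right (sq_nonneg d) (mul_le_one₀ hvt hvs0 hvs)
    have h2 := hmul (a := d * field δ t (flip s x) * spinDeriv s (condVar θ t) x) hvs0 hvs
    rw [abs_mul, abs_mul] at h2
    linarith
  have t2 := hmul (a := field δ t x * field δ s (flip t x) * spinDeriv t (residual θ s) x)
    hvt0 hvt
  rw [abs_mul, abs_mul] at t2
  have ht := sq_abs (field δ t x)
  have hs := sq_abs (field δ s x)
  have hd2 := sq_abs d
  have hdW : e * d ^ 2 ≤ W * d ^ 2 := mul_le_mul_of_nonneg_right heW (sq_nonneg d)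
  have q1 : e * (2 * (|d| * |field δ t x|)) ≤ e * (d ^ 2 + field δ t x ^ 2) :=
    mul_le_mul_of_nonneg_left (by nlinarith [sq_nonneg (|d| - |field δ t x|)]) he0
  have q2 : e * (2 * (|field δ s x| * |field δ t x|)) ≤ e * (field δ s x ^ 2 + field δ t x ^ 2) :=
    mul_le_mul_of_nonneg_left (by nlinarith [sq_nonneg (|field δ s x| - |field δ t x|)]) he0
  have q3 : 0 ≤ e * field δ s x ^ 2 := by positivity
  have q4 : 0 ≤ e * field δ t x ^ 2 := by positivity
  nlinarith

end RowBounded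

/-- The lower bound on the variance of an Ising energy per unit of squared edge weight. -/
noncomputable def varianceConst (W : ℝ) : ℝ :=
  (Real.cosh W ^ 2)⁻¹ ^ 2 / (1 + 4 * W + (1 + 6 * W) / ((Real.cosh W ^ 2)⁻¹ ^ 2 / (1 + W))) *
    ((Real.cosh W ^ 2)⁻¹ ^ 2 / (1 + W))

theorem varianceConst_pos {W : ℝ} (hW : 0 ≤ W) : 0 < varianceConst W := by
  have := Real.cosh_pos W
  unfold varianceConst
  positivity

/-- The variance of an energy function in a model with bounded neighborhood weights is at least a
multiple of the total squared weight. -/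
theorem RowBounded.sum_sq_le_variance {θ δ : EdgeWeights p} {W : ℝ} (hθ : RowBounded θ W)
    (hW : 0 ≤ W) (hδ : ∀ s, δ s(s, s) = 0) :
    varianceConst W * ∑ s, ∑ t, δ s(s, t) ^ 2 ≤
      expect θ (fun x => energy δ x ^ 2) - expect θ (energy δ) ^ 2 := by
  unfold varianceConst
  set c := (Real.cosh W ^ 2)⁻¹ with hc
  have hcpos : 0 < c := by have := Real.cosh_pos W; positivity
  -- The constant of `sum_sq_le_expect_sq`, applied to the linear forms `field δ s`.
  set c' := c ^ 2 / (1 + W) with hc'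
  have hc'pos : 0 < c' := by positivity
  set Δ := ∑ s, ∑ t, δ s(s, t) ^ 2 with hΔ
  set H := ∑ s, expect θ (fun x => field δ s x ^ 2) with hH
  -- In the second moment of `g`, the diagonal gives `1`, the terms with `|θ_st|` give `3 * W + W`,
  -- and the terms with `δ_st ^ 2` give the last summand through `c' * Δ ≤ H`.
  set K := 1 + 4 * W + (1 + 6 * W) / c' with hK
  have hKpos : 0 < K := by positivity
  have hΔH : c' * Δ ≤ H := by
    rw [hΔ, hH, Finset.mul_sum]
    exact Finset.sum_le_sum fun s _ => hθ.sum_sq_le_expect_sq hW fun t => δ s(s, t)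
  have hsq0 : ∀ s, 0 ≤ expect θ (fun x => field δ s x ^ 2) := fun s =>
    expect_nonneg θ fun x => sq_nonneg _
  have hH0 : 0 ≤ H := Finset.sum_nonneg fun s _ => hsq0 s
  set m := expect θ (energy δ) with hm
  set f : Config p → ℝ := fun x => energy δ x + -m with hf
  set g : Config p → ℝ := fun x => ∑ s, field δ s x * residual θ s x with hg
  have hvareq : expect θ (fun x => f x ^ 2) = expect θ (fun x => energy δ x ^ 2) - m ^ 2 := by
    have e : (fun x => f x ^ 2) = fun x => energy δ x ^ 2 + ((-2 * m) * energy δ x + m ^ 2) := by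
      funext x; simp only [hf]; ring
    rw [e, expect_add, expect_add, expect_const_mul, expect_const, ← hm]
    ring
  have hDf : ∀ s x, spinDeriv s f x = field δ s x := fun s x => by
    rw [← spinDeriv_energy hδ]
    simp only [spinDeriv, hf]; ring
  have hcov : c * H ≤ expect θ (fun x => f x * g x) := by
    have e : (fun x => f x * g x) = fun x => ∑ s, (f x * field δ s x) * residual θ s x := by
      funext x; simp only [hg, Finset.mul_sum]
      exact Finset.sum_congr rfl fun t _ => by ring
    rw [e, expect_sum, hH, Finset.mul_sum]
    refine Finset.sum_le_sum fun s _ => ?_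
    rw [expect_mul_residual hθ.diag, ← expect_const_mul]
    refine expect_mono θ fun x => ?_
    -- The field at `s` does not involve `x_s`, so only the square of the field survives.
    rw [spinDeriv_mul, hDf, spinDeriv_field, hδ]
    nlinarith [mul_le_mul_of_nonneg_left (hθ.le_condVar s x) (sq_nonneg (field δ s x))]
  have hdiag : ∀ s, expect θ (fun x => (field δ s x * residual θ s x) *
      (field δ s x * residual θ s x)) ≤ expect θ (fun x => field δ s x ^ 2) := fun s => by
    have e : (fun x => (field δ s x * residual θ s x) * (field δ s x * residual θ s x)) =
        fun x => (field δ s x * (field δ s x * residual θ s x)) * residual θ s x := by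
      funext x; ring
    rw [e, expect_mul_residual hθ.diag]
    refine expect_mono θ fun x => ?_
    rw [spinDeriv_mul, spinDeriv_mul, spinDeriv_field, hδ, spinDeriv_residual_self hθ.diag,
      field_flip, hδ]
    nlinarith [mul_le_mul_of_nonneg_left (condVar_le_one θ s x) (sq_nonneg (field δ s x))]
  have hvar : expect θ (fun x => g x ^ 2) ≤ K * H := by
    have e : (fun x => g x ^ 2) = fun x => ∑ s, ∑ t, (field δ s x * residual θ s x) *
        (field δ t x * residual θ t x) := by
      funext x; simp only [hg, sq, Finset.sum_mul_sum]
    rw [e]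
    simp only [expect_sum]
    have hstep : ∑ s, ∑ t, expect θ (fun x => (field δ s x * residual θ s x) *
        (field δ t x * residual θ t x)) ≤
        ∑ s, ∑ t, ((if s = t then expect θ (fun x => field δ s x ^ 2) else 0) +
          ((1 + 6 * W) * δ s(s, t) ^ 2 +
          (|θ s(s, t)| * (3 * expect θ (fun x => field δ t x ^ 2)) +
            |θ s(s, t)| * expect θ (fun x => field δ s x ^ 2)))) := by
      refine Finset.sum_le_sum fun s _ => Finset.sum_le_sum fun t _ => ?_
      by_cases hst : s = t
      · subst hst
        simpa [hδ, hθ.diag] using hdiag s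
      · simpa [hst, mul_assoc, mul_left_comm] using hθ.expect_field_residual_mul_le hδ hst
    refine hstep.trans ?_
    simp only [Finset.sum_add_distrib, ← Finset.mul_sum]
    have h1 := hθ.sum_abs_mul_left_le hsq0
    have h2 := hθ.sum_abs_mul_right_le
      (a := fun s => 3 * expect θ (fun x => field δ s x ^ 2)) fun s => by linarith [hsq0 s]
    have h3 : (1 + 6 * W) * Δ ≤ (1 + 6 * W) / c' * H := by
      rw [div_mul_eq_mul_div, le_div_iff₀ hc'pos]
      nlinarith [mul_le_mul_of_nonneg_left hΔH (show 0 ≤ 1 + 6 * W by positivity)]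
    rw [← Finset.mul_sum] at h2
    simp only [Finset.mul_sum, Finset.sum_ite_eq, Finset.mem_univ, if_true] at h1 h2 h3 ⊢
    simp only [← Finset.mul_sum] at h1 h2 h3 ⊢
    rw [← hΔ, ← hH] at *
    rw [hK]
    linarith
  have hcs := expect_mul_sq_le θ f g
  have h1 : (c * H) ^ 2 ≤ expect θ (fun x => f x ^ 2) * (K * H) :=
    (pow_le_pow_left₀ (by positivity) hcov 2).trans (hcs.trans
      (mul_le_mul_of_nonneg_left hvar (expect_nonneg θ fun x => sq_nonneg _)))
  rw [← hvareq]
  have h2 : c ^ 2 / K * H ≤ expect θ (fun x => f x ^ 2) := by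
    rcases hH0.eq_or_lt with h0 | h0
    · rw [← h0, mul_zero]
      exact expect_nonneg θ fun x => sq_nonneg _
    · rw [div_mul_eq_mul_div, div_le_iff₀ hKpos]
      refine le_of_mul_le_mul_right ?_ h0
      calc c ^ 2 * H * H = (c * H) ^ 2 := by ring
        _ ≤ _ := h1
        _ = _ := by ring
  calc c ^ 2 / K * c' * Δ = c ^ 2 / K * (c' * Δ) := by ring
    _ ≤ c ^ 2 / K * H := mul_le_mul_of_nonneg_left hΔH (by positivity)
    _ ≤ _ := h2

/-! ### Strong convexity of the log-partition function and Bhattacharyya coefficients. -/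

section LogPartition

variable {α : Type*} [Fintype α] [Nonempty α]

/-- If the variance of `f` along the exponential family with weights `exp (e + t f)` is at least
`κ` for `t ∈ [-1, 1]`, then the log-partition function is midpoint convex with gap `κ`. -/
theorem log_sum_exp_midpoint_gap (e f : α → ℝ) (κ : ℝ)
    (hvar : ∀ t ∈ Set.Icc (-1 : ℝ) 1,
      κ ≤ (∑ x, f x ^ 2 * Real.exp (e x + t * f x)) / (∑ x, Real.exp (e x + t * f x)) -
        ((∑ x, f x * Real.exp (e x + t * f x)) / (∑ x, Real.exp (e x + t * f x))) ^ 2) :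
    2 * Real.log (∑ x, Real.exp (e x)) + κ ≤
      Real.log (∑ x, Real.exp (e x + f x)) + Real.log (∑ x, Real.exp (e x - f x)) := by
  set Z : ℕ → ℝ → ℝ := fun j t => ∑ x, f x ^ j * Real.exp (e x + t * f x) with hZ
  have hZ0 : ∀ t, Z 0 t = ∑ x, Real.exp (e x + t * f x) := fun t => by simp [hZ]
  have hpos : ∀ t, 0 < Z 0 t := fun t => by
    rw [hZ0]; exact Finset.sum_pos (fun _ _ => Real.exp_pos _) Finset.univ_nonempty
  have hderiv : ∀ j t, HasDerivAt (Z j) (Z (j + 1) t) t := fun j t => by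
    refine HasDerivAt.fun_sum fun x _ => ?_
    have h := ((((hasDerivAt_id t).mul_const (f x)).const_add (e x)).exp).const_mul (f x ^ j)
    refine h.congr_deriv ?_
    simp only [id, one_mul]; ring
  -- The second derivative of `log (Z 0)` is a variance, at least `κ`, so subtracting this quadratic
  -- leaves a convex function. Midpoint convexity on `-1, 0, 1` gives the gap.
  set F : ℝ → ℝ := fun t => Real.log (Z 0 t) - κ / 2 * t ^ 2 with hF
  have hF1 : ∀ t, HasDerivAt F (Z 1 t / Z 0 t - κ * t) t := fun t => by
    have h := ((hderiv 0 t).log (hpos t).ne').sub ((hasDerivAt_pow 2 t).const_mul (κ / 2))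
    refine h.congr_deriv ?_
    simp; ring
  have hF2 : ∀ t, HasDerivAt (fun t => Z 1 t / Z 0 t - κ * t)
      (Z 2 t / Z 0 t - (Z 1 t / Z 0 t) ^ 2 - κ) t := fun t => by
    have h := ((hderiv 1 t).div (hderiv 0 t) (hpos t).ne').sub ((hasDerivAt_id t).const_mul κ)
    refine h.congr_deriv ?_
    have := (hpos t).ne'
    field_simp
  have hconv : ConvexOn ℝ (Set.Icc (-1 : ℝ) 1) F := by
    refine convexOn_of_hasDerivWithinAt2_nonneg (convex_Icc _ _)
      (fun t _ => (hF1 t).continuousAt.continuousWithinAt)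
      (fun t _ => (hF1 t).hasDerivWithinAt) (fun t _ => (hF2 t).hasDerivWithinAt) fun t ht => ?_
    have h := hvar t (interior_subset ht)
    simp only [hZ, pow_zero, one_mul, pow_one]
    linarith
  have hmid := hconv.2 (show (1 : ℝ) ∈ Set.Icc (-1) 1 by simp)
    (show (-1 : ℝ) ∈ Set.Icc (-1) 1 by simp) (show (0 : ℝ) ≤ 1 / 2 by norm_num)
    (show (0 : ℝ) ≤ 1 / 2 by norm_num) (by norm_num)
  norm_num [hF, hZ0, ← sub_eq_add_neg] at hmid
  linarith

end LogPartition

theorem energy_add_smul (μ δ : EdgeWeights p) (t : ℝ) (x : Config p) :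
    energy (μ + t • δ) x = energy μ x + t * energy δ x := by
  simp only [energy, Finset.mul_sum, ← Finset.sum_add_distrib, Pi.add_apply, Pi.smul_apply,
    smul_eq_mul]
  exact Finset.sum_congr rfl fun s _ => Finset.sum_congr rfl fun t _ => by ring

theorem expect_eq_div (θ : EdgeWeights p) (F : Config p → ℝ) :
    expect θ F = (∑ x, F x * Real.exp (energy θ x)) / ∑ x, Real.exp (energy θ x) := by
  rw [← partitionFunction, Finset.sum_div]
  exact Finset.sum_congr rfl fun x _ => by rw [isingProb]; ring

/-- For `t` in `[-1, 1]` these weights are convex combinations of `θ` and `θ'`. -/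
theorem RowBounded.segment {θ θ' : EdgeWeights p} {W t : ℝ} (hθ : RowBounded θ W)
    (hθ' : RowBounded θ' W) (ht : t ∈ Set.Icc (-1 : ℝ) 1) :
    RowBounded ((2⁻¹ : ℝ) • (θ + θ') + t • ((2⁻¹ : ℝ) • (θ - θ'))) W where
  diag s := by simp [hθ.diag, hθ'.diag]
  row s := by
    have h1 : 0 ≤ (1 + t) / 2 := by linarith [ht.1]
    have h2 : 0 ≤ (1 - t) / 2 := by linarith [ht.2]
    calc ∑ r, |((2⁻¹ : ℝ) • (θ + θ') + t • ((2⁻¹ : ℝ) • (θ - θ'))) s(s, r)|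
        ≤ ∑ r, ((1 + t) / 2 * |θ s(s, r)| + (1 - t) / 2 * |θ' s(s, r)|) := by
          refine Finset.sum_le_sum fun r _ => ?_
          rw [← abs_of_nonneg (mul_nonneg h1 (abs_nonneg (θ s(s, r)))),
            ← abs_of_nonneg (mul_nonneg h2 (abs_nonneg (θ' s(s, r)))), abs_mul, abs_abs,
            ← abs_mul, abs_mul ((1 - t) / 2), abs_abs, ← abs_mul]
          refine le_of_eq_of_le ?_ (abs_add_le _ _)
          simp only [Pi.add_apply, Pi.smul_apply, Pi.sub_apply, smul_eq_mul]
          congr 1; ring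
      _ ≤ (1 + t) / 2 * W + (1 - t) / 2 * W := by
          rw [Finset.sum_add_distrib, ← Finset.mul_sum, ← Finset.mul_sum]
          exact add_le_add (mul_le_mul_of_nonneg_left (hθ.row s) h1)
            (mul_le_mul_of_nonneg_left (hθ'.row s) h2)
      _ = W := by ring

/-- The Bhattacharyya coefficient of two Ising models with bounded neighborhood weights decays
exponentially in the squared distance of the weights. -/
theorem bhattacharyya_le {θ θ' : EdgeWeights p} {W : ℝ} (hW : 0 ≤ W) (hθ : RowBounded θ W)
    (hθ' : RowBounded θ' W) :
    ∑ x, √(isingProb θ x * isingProb θ' x) ≤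
      Real.exp (-(varianceConst W / 8 * ∑ s, ∑ t, (θ s(s, t) - θ' s(s, t)) ^ 2)) := by
  set μ : EdgeWeights p := (2⁻¹ : ℝ) • (θ + θ') with hμ
  set δ : EdgeWeights p := (2⁻¹ : ℝ) • (θ - θ') with hδ
  set Δ := ∑ s, ∑ t, (θ s(s, t) - θ' s(s, t)) ^ 2 with hΔ
  have hδΔ : ∑ s, ∑ t, δ s(s, t) ^ 2 = Δ / 4 := by
    simp only [hΔ, Finset.sum_div]
    refine Finset.sum_congr rfl fun s _ => Finset.sum_congr rfl fun t _ => ?_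
    simp only [hδ, Pi.smul_apply, Pi.sub_apply, smul_eq_mul]; ring
  -- Halving the difference costs a factor 4 in the squared weights; the square root in the
  -- coefficient costs a further 2, whence the 8.
  have hgap := log_sum_exp_midpoint_gap (energy μ) (energy δ) (varianceConst W * (Δ / 4))
    fun t ht => by
      have h := (hθ.segment hθ' ht).sum_sq_le_variance (δ := δ) hW fun s => by
        simp [hδ, hθ.diag, hθ'.diag]
      rw [hδΔ, ← hμ, ← hδ, expect_eq_div, expect_eq_div] at h
      simpa only [energy_add_smul] using h
  have e1 : ∀ x, energy μ x + energy δ x = energy θ x := fun x => by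
    rw [← one_mul (energy δ x), ← energy_add_smul]
    congr 1
    rw [hμ, hδ]; module
  have e2 : ∀ x, energy μ x - energy δ x = energy θ' x := fun x => by
    rw [sub_eq_add_neg, ← neg_one_mul (energy δ x), ← energy_add_smul]
    congr 1
    rw [hμ, hδ]; module
  simp only [e1, e2] at hgap
  rw [← partitionFunction, ← partitionFunction, ← partitionFunction] at hgap
  have hZ := partitionFunction_pos θ
  have hZ' := partitionFunction_pos θ'
  have hZμ := partitionFunction_pos μ
  have hsqrt : ∀ x, √(isingProb θ x * isingProb θ' x) = Real.exp (energy μ x) *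
      Real.exp (-((Real.log (partitionFunction θ) + Real.log (partitionFunction θ')) / 2)) :=
    fun x => by
      rw [Real.sqrt_eq_iff_mul_self_eq (mul_pos (isingProb_pos _ _) (isingProb_pos _ _)).le
        (by positivity), isingProb, isingProb, ← e1, ← e2]
      rw [show partitionFunction θ = Real.exp (Real.log (partitionFunction θ)) from
        (Real.exp_log hZ).symm, show partitionFunction θ' = Real.exp (Real.log (partitionFunction θ'))
        from (Real.exp_log hZ').symm]
      simp only [Real.log_exp, ← Real.exp_sub, ← Real.exp_add]
      congr 1; ring
  simp only [hsqrt, ← Finset.sum_mul]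
  rw [← partitionFunction, ← Real.exp_log hZμ, ← Real.exp_add, Real.exp_le_exp]
  linarith

/-! ### Maximum likelihood decoding. -/

section MaximumLikelihood

/-- Maximum likelihood among finitely many distributions: the error probability is at most the sum
of the Bhattacharyya coefficients. -/
theorem exists_maximumLikelihood {ι α : Type*} [Fintype α] [DecidableEq ι] [Nonempty ι]
    (P : ι → α → ℝ)
    (hP : ∀ i x, 0 ≤ P i x) (A : Finset ι) (n : ℕ) :
    ∃ φ : (Fin n → α) → ι, ∀ i ∈ A,
      ∑ X with φ X ≠ i, ∏ k, P i (X k) ≤ ∑ j ∈ A.erase i, (∑ x, √(P i x * P j x)) ^ n := by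
  rcases A.eq_empty_or_nonempty with rfl | hA
  · exact ⟨fun _ => Classical.arbitrary ι, by simp⟩
  choose φ hφA hφ using fun X : Fin n → α => A.exists_max_image (fun i => ∏ k, P i (X k)) hA
  refine ⟨φ, fun i hi => ?_⟩
  have hL : ∀ j (X : Fin n → α), 0 ≤ ∏ k, P j (X k) := fun j X =>
    Finset.prod_nonneg fun k _ => hP j _
  calc ∑ X with φ X ≠ i, ∏ k, P i (X k)
      ≤ ∑ X with φ X ≠ i, ∑ j ∈ A.erase i, ∏ k, √(P i (X k) * P j (X k)) := by
        refine Finset.sum_le_sum fun X hX => ?_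
        have hne : φ X ≠ i := (Finset.mem_filter.1 hX).2
        -- On an error the likelihood of `i` is at most that of `φ X`, hence at most the geometric
        -- mean of the two; this is the term `j = φ X` of the sum.
        refine le_trans ?_ (Finset.single_le_sum
          (f := fun j => ∏ k, √(P i (X k) * P j (X k)))
          (fun j _ => Finset.prod_nonneg fun k _ => Real.sqrt_nonneg _)
          (Finset.mem_erase.2 ⟨hne, hφA X⟩))
        rw [← Real.sqrt_prod _ fun k _ => mul_nonneg (hP _ _) (hP _ _), Finset.prod_mul_distrib]
        refine Real.le_sqrt_of_sq_le ?_
        rw [sq]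
        exact mul_le_mul_of_nonneg_left (hφ X i hi) (hL _ _)
    _ ≤ ∑ X : Fin n → α, ∑ j ∈ A.erase i, ∏ k, √(P i (X k) * P j (X k)) := by
        refine Finset.sum_le_univ_sum_of_nonneg fun X => ?_
        exact Finset.sum_nonneg fun j _ => Finset.prod_nonneg fun k _ => Real.sqrt_nonneg _
    _ = ∑ j ∈ A.erase i, (∑ x, √(P i x * P j x)) ^ n := by
        rw [Finset.sum_comm]
        simp only [Fintype.sum_pow]

end MaximumLikelihood

/-! ### Counting graphs by their edge differences. -/

section GraphDifference

open Classical in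
/-- The ordered pairs on which the adjacency relations of two graphs differ. -/
noncomputable def adjDiff (G G' : SimpleGraph (Fin p)) : Finset (Fin p × Fin p) :=
  {e | ¬ (G.Adj e.1 e.2 ↔ G'.Adj e.1 e.2)}

theorem adjDiff_injective (G : SimpleGraph (Fin p)) : Function.Injective (adjDiff G) := by
  intro G₁ G₂ h
  ext s t
  have := Finset.ext_iff.1 h (s, t)
  simp only [adjDiff, Finset.mem_filter, Finset.mem_univ, true_and] at this
  tauto

theorem adjDiff_nonempty {G G' : SimpleGraph (Fin p)} (h : G' ≠ G) : adjDiff G G' ≠ ∅ := by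
  intro h0
  refine h (adjDiff_injective G (h0.trans ?_))
  simp [adjDiff]

-- With `G` fixed, other graphs correspond injectively to nonempty difference sets. Dropping the
-- requirement that such a set come from a graph leaves a binomial expansion.
open Classical in
theorem sum_pow_card_adjDiff_le {q : ℝ} (hq : 0 ≤ q) (G : SimpleGraph (Fin p))
    (A : Finset (SimpleGraph (Fin p))) (hA : G ∉ A) :
    ∑ G' ∈ A, q ^ (adjDiff G G').card ≤ Real.exp (p ^ 2 * q) - 1 := by
  have h1 : ∑ G' ∈ A, q ^ (adjDiff G G').card = ∑ D ∈ A.image (adjDiff G), q ^ D.card :=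
    (Finset.sum_image (f := fun D => q ^ D.card) fun _ _ _ _ h => adjDiff_injective G h).symm
  have h2 : ∑ D ∈ A.image (adjDiff G), q ^ D.card ≤
      ∑ D ∈ Finset.univ.erase (∅ : Finset (Fin p × Fin p)), q ^ D.card := by
    refine Finset.sum_le_sum_of_subset_of_nonneg (fun D hD => ?_) fun _ _ _ => by positivity
    obtain ⟨G', hG', rfl⟩ := Finset.mem_image.1 hD
    exact Finset.mem_erase.2 ⟨adjDiff_nonempty fun h => hA (h ▸ hG'), Finset.mem_univ _⟩
  have h3 := Fintype.sum_pow_mul_eq_add_pow (Fin p × Fin p) q 1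
  simp only [one_pow, mul_one, Fintype.card_prod, Fintype.card_fin] at h3
  have h4 := Finset.add_sum_erase Finset.univ
    (fun D : Finset (Fin p × Fin p) => q ^ D.card) (Finset.mem_univ ∅)
  simp only [Finset.card_empty, pow_zero, h3] at h4
  have h5 : (q + 1) ^ (p * p) ≤ Real.exp (p ^ 2 * q) := by
    refine (pow_le_pow_left₀ (by positivity) (Real.add_one_le_exp q) _).trans_eq ?_
    rw [← Real.exp_nat_mul]
    push_cast
    ring_nf
  linarith

variable {G G' : SimpleGraph (Fin p)} {lam om om' : ℝ} {θ θ' : EdgeWeights p}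

theorem IsAdmissible.rowBounded (h : IsAdmissible G lam om θ) {W : ℝ} (hom : om ≤ W) :
    RowBounded θ W where
  diag s := h.support s s (G.loopless.irrefl s)
  row s := by
    classical
    refine le_trans (le_of_eq ?_) ((h.neighborhoodWeight s).trans hom)
    rw [Finset.sum_filter]
    refine Finset.sum_congr rfl fun t _ => ?_
    split_ifs with hst
    · rfl
    · rw [h.support s t hst, abs_zero]

/-- On a differing pair one weight vanishes and the other is at least `lam` in absolute value. Both
sides count ordered pairs. -/
theorem IsAdmissible.card_adjDiff_le (h : IsAdmissible G lam om θ)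
    (h' : IsAdmissible G' lam om' θ') (hlam : 0 ≤ lam) :
    lam ^ 2 * (adjDiff G G').card ≤ ∑ s, ∑ t, (θ s(s, t) - θ' s(s, t)) ^ 2 := by
  rw [← Fintype.sum_prod_type' (fun s t => (θ s(s, t) - θ' s(s, t)) ^ 2), mul_comm,
    ← nsmul_eq_mul]
  refine (Finset.card_nsmul_le_sum _ _ _ fun e he => ?_).trans
    (Finset.sum_le_sum_of_subset_of_nonneg (Finset.subset_univ (adjDiff G G'))
      fun _ _ _ => sq_nonneg _)
  simp only [adjDiff, Finset.mem_filter, Finset.mem_univ, true_and] at he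
  rw [← sq_abs (_ - _)]
  refine pow_le_pow_left₀ hlam ?_ 2
  by_cases hG : G.Adj e.1 e.2
  · have hG' : ¬ G'.Adj e.1 e.2 := fun h => he ⟨fun _ => h, fun _ => hG⟩
    rw [h'.support _ _ hG', sub_zero]
    exact h.minWeight _ _ hG
  · have hG' : G'.Adj e.1 e.2 := by tauto
    rw [h.support _ _ hG, zero_sub, abs_neg]
    exact h'.minWeight _ _ hG'

end GraphDifference

/-! ### The decoder and the choice of constants. -/

/-- Maximum likelihood decoding for known edge weights. -/
theorem exists_decoder_errorProb_le {n d : ℕ} {lam om W q : ℝ} (hW : 0 ≤ W) (hlam : 0 ≤ lam)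
    (hom : om ≤ W) (hq : Real.exp (-(n * (varianceConst W / 8 * lam ^ 2))) ≤ q)
    (θ : SimpleGraph (Fin p) → EdgeWeights p) :
    ∃ φ : Decoder n p d, ∀ G ∈ boundedDegreeGraphs p d, IsAdmissible G lam om (θ G) →
      errorProb φ (θ G) G ≤ Real.exp (p ^ 2 * q) - 1 := by
  classical
  have hq0 : 0 ≤ q := (Real.exp_pos _).le.trans hq
  have : Nonempty (boundedDegreeGraphs p d) := ⟨⟨⊥, fun s => by simp⟩⟩
  let A : Finset (boundedDegreeGraphs p d) := Finset.univ.filter fun G =>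
    IsAdmissible (G : SimpleGraph (Fin p)) lam om (θ G)
  obtain ⟨φ, hφ⟩ := exists_maximumLikelihood
    (fun (G : boundedDegreeGraphs p d) x => isingProb (θ G) x)
    (fun G x => (isingProb_pos _ x).le) A n
  refine ⟨φ, fun G hG hadm => ?_⟩
  have hGA : (⟨G, hG⟩ : boundedDegreeGraphs p d) ∈ A :=
    Finset.mem_filter.2 ⟨Finset.mem_univ _, hadm⟩
  have herr : errorProb φ (θ G) G =
      ∑ X with φ X ≠ ⟨G, hG⟩, ∏ k, isingProb (θ G) (X k) := by
    rw [errorProb]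
    refine Finset.sum_congr ?_ fun _ _ => rfl
    ext X
    rw [Finset.mem_filter, Finset.mem_filter, ne_eq, ne_eq, Subtype.ext_iff]
  have hpair : ∀ G' ∈ A.erase ⟨G, hG⟩,
      (∑ x, √(isingProb (θ G) x * isingProb (θ G') x)) ^ n ≤
        q ^ (adjDiff G (G' : SimpleGraph (Fin p))).card := fun G' hG' => by
    have hadm' : IsAdmissible (G' : SimpleGraph (Fin p)) lam om (θ G') :=
      (Finset.mem_filter.1 (Finset.mem_erase.1 hG').2).2
    have hb := bhattacharyya_le hW (hadm.rowBounded hom) (hadm'.rowBounded hom)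
    have hc := hadm.card_adjDiff_le hadm' hlam
    refine (pow_le_pow_left₀ (Finset.sum_nonneg fun _ _ => Real.sqrt_nonneg _) hb n).trans ?_
    refine le_trans ?_ (pow_le_pow_left₀ (Real.exp_pos _).le hq _)
    rw [← Real.exp_nat_mul, ← Real.exp_nat_mul, Real.exp_le_exp]
    have hκ := varianceConst_pos hW
    have := mul_le_mul_of_nonneg_left hc (show 0 ≤ n * (varianceConst W / 8) by positivity)
    linarith
  have hcount := sum_pow_card_adjDiff_le hq0 G
    ((A.erase ⟨G, hG⟩).map (Function.Embedding.subtype _)) fun hmem => by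
      obtain ⟨G', hG', h⟩ := Finset.mem_map.1 hmem
      exact (Finset.mem_erase.1 hG').1 (Subtype.ext h)
  rw [Finset.sum_map] at hcount
  rw [herr]
  exact (hφ _ hGA).trans ((Finset.sum_le_sum hpair).trans hcount)

end IsingSelection

theorem corollary3 (W : ℝ) (hW : 0 < W) :
    ∃ c₁ : ℝ, 0 < c₁ ∧
      ∀ (n p d : ℕ → ℕ) (lam om : ℕ → ℝ),
        Tendsto d atTop atTop →
        (∀ k, d k < p k) →
        (∀ k, 0 < lam k) →
        (∀ k, 0 < om k ∧ om k ≤ W) →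
        (∀ k, (n k : ℝ) >
          c₁ * max ((d k : ℝ) ^ 2) (1 / lam k ^ 2) * (d k : ℝ) * Real.log (p k : ℝ)) →
        ∃ δ : ℕ → ℝ, Tendsto δ atTop (𝓝 0) ∧
          ∀ (k : ℕ) (θ : SimpleGraph (Fin (p k)) → IsingSelection.EdgeWeights (p k)),
            ∃ φ : IsingSelection.Decoder (n k) (p k) (d k),
              ∀ G ∈ IsingSelection.boundedDegreeGraphs (p k) (d k),
                IsingSelection.IsAdmissible G (lam k) (om k) (θ G) →
                  IsingSelection.errorProb φ (θ G) G ≤ δ k := by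
  have hκ := IsingSelection.varianceConst_pos hW.le
  set κ := IsingSelection.varianceConst W
  -- Through the bound `1 / lam ^ 2` on the maximum, this makes the exponent `n * (κ / 8) * lam ^ 2`
  -- at least `4 * d * log p`.
  refine ⟨32 / κ, by positivity, fun n p d lam om hd hdp hlam hom hn => ?_⟩
  -- Here `q = p ^ (-4 d)`; once `d ≥ 1`, `p ≥ 2` gives `log p ≥ 1 / 2` and so `p ^ 2 * q ≤ exp
  -- (-d)`.
  refine ⟨fun k => Real.exp ((p k : ℝ) ^ 2 * Real.exp (-(4 * d k * Real.log (p k)))) - 1, ?_,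
    fun k θ => IsingSelection.exists_decoder_errorProb_le hW.le (hlam k).le (hom k).2 ?_ θ⟩
  · have hlim : Tendsto (fun k => Real.exp (-(d k : ℝ))) atTop (𝓝 0) :=
      Real.tendsto_exp_neg_atTop_nhds_zero.comp (tendsto_natCast_atTop_atTop.comp hd)
    have hsq : Tendsto (fun k => (p k : ℝ) ^ 2 * Real.exp (-(4 * d k * Real.log (p k)))) atTop
        (𝓝 0) := by
      refine squeeze_zero' (.of_forall fun k => by positivity) ?_ hlim
      filter_upwards [hd.eventually_ge_atTop 1] with k hk
      have hd1 : (1 : ℝ) ≤ d k := by exact_mod_cast hk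
      have hp2 : (2 : ℝ) ≤ p k := by exact_mod_cast (show 2 ≤ p k from by have := hdp k; omega)
      have hlog : 1 / 2 ≤ Real.log (p k) := by
        have h1 := Real.log_le_log two_pos hp2
        have h2 := Real.log_two_gt_d9
        linarith
      have hpexp : (p k : ℝ) ^ 2 = Real.exp (2 * Real.log (p k)) := by
        rw [mul_comm, Real.exp_mul, Real.exp_log (by linarith)]
        norm_num
      rw [hpexp, ← Real.exp_add, Real.exp_le_exp]
      nlinarith [mul_le_mul_of_nonneg_left hlog (show (0 : ℝ) ≤ d k by linarith),
        mul_le_mul_of_nonneg_right hd1 (show 0 ≤ Real.log (p k) by linarith)]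
    simpa using (Real.continuous_exp.tendsto 0).comp hsq |>.sub_const 1
  · rw [Real.exp_le_exp, neg_le_neg_iff]
    have hl := hlam k
    have hdl : 0 ≤ (d k : ℝ) * Real.log (p k) :=
      mul_nonneg (Nat.cast_nonneg _) (Real.log_natCast_nonneg _)
    have h1 : 32 / κ * (1 / lam k ^ 2) * ((d k : ℝ) * Real.log (p k)) ≤ n k := by
      refine le_trans ?_ (hn k).le
      rw [mul_assoc (32 / κ * max _ _)]
      have := le_max_right ((d k : ℝ) ^ 2) (1 / lam k ^ 2)
      gcongr
    have h2 := mul_le_mul_of_nonneg_right h1 (show 0 ≤ κ / 8 * lam k ^ 2 by positivity)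
    refine le_of_eq_of_le ?_ h2
    field_simp
    ring
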